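/- Let $L_4^1=\langle a,b,1\mid a^2=a,\ b^2=b,\ abab=0\rangle$ be the monoid with zero given by this presentation, i.e. the quotient of the free monoid with zero on $a,b$ by the least congruence containing the three defining relations. Then $L_4^1$ has exactly $9$ elements and is non-finitely based: there is no finite set $E$ of identities $u\approx v$ (between words over a countably infinite alphabet) that hold in $L_4^1$ such that every identity holding in $L_4^1$ can be deduced from $E$. This is true both when $L_4^1$ is regarded as a monoid (words may be empty, and variables may be replaced by arbitrary, possibly empty, words) and when it is regarded as a semigroup (words are nonempty, and variables are replaced by nonempty words). -/

import Mathlib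

/-- Words over a countably infinite alphabet of variables, the empty word included: the elements
of the free monoid. -/
abbrev MonoidWord : Type := FreeMonoid ℕ

/-- Nonempty words over a countably infinite alphabet of variables: the elements of the free
semigroup. -/
abbrev SemigroupWord : Type := FreeSemigroup ℕ

/-- The monoid `M` satisfies the identity `u ≈ v`: the two sides agree under every substitution
of elements of `M` for the variables (the empty word takes the value `1`). -/
def MonoidSatisfies (M : Type*) [Monoid M] (u v : MonoidWord) : Prop :=
  ∀ θ : ℕ → M, FreeMonoid.lift θ u = FreeMonoid.lift θ v

/-- The semigroup `S` satisfies the identity `u ≈ v` between nonempty words. -/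
def SemigroupSatisfies (S : Type*) [Semigroup S] (u v : SemigroupWord) : Prop :=
  ∀ θ : ℕ → S, FreeSemigroup.lift θ u = FreeSemigroup.lift θ v

/-- Equational deduction in the signature of monoids: `MonoidDeduces E u v` says that the identity
`u ≈ v` can be deduced from the set of identities `E`. Variables may be replaced by arbitrary
words, including the empty word. -/
inductive MonoidDeduces (E : Set (MonoidWord × MonoidWord)) : MonoidWord → MonoidWord → Prop
  | subst (p : MonoidWord × MonoidWord) (hp : p ∈ E) (θ : ℕ → MonoidWord) :
      MonoidDeduces E (FreeMonoid.lift θ p.1) (FreeMonoid.lift θ p.2)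
  | refl (u : MonoidWord) : MonoidDeduces E u u
  | symm {u v : MonoidWord} : MonoidDeduces E u v → MonoidDeduces E v u
  | trans {u v w : MonoidWord} : MonoidDeduces E u v → MonoidDeduces E v w → MonoidDeduces E u w
  | mul {u v u' v' : MonoidWord} :
      MonoidDeduces E u v → MonoidDeduces E u' v' → MonoidDeduces E (u * u') (v * v')

/-- Equational deduction in the signature of semigroups. Variables may be replaced by arbitrary
nonempty words. -/
inductive SemigroupDeduces (E : Set (SemigroupWord × SemigroupWord)) :
    SemigroupWord → SemigroupWord → Prop
  | subst (p : SemigroupWord × SemigroupWord) (hp : p ∈ E) (θ : ℕ → SemigroupWord) :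
      SemigroupDeduces E (FreeSemigroup.lift θ p.1) (FreeSemigroup.lift θ p.2)
  | refl (u : SemigroupWord) : SemigroupDeduces E u u
  | symm {u v : SemigroupWord} : SemigroupDeduces E u v → SemigroupDeduces E v u
  | trans {u v w : SemigroupWord} :
      SemigroupDeduces E u v → SemigroupDeduces E v w → SemigroupDeduces E u w
  | mul {u v u' v' : SemigroupWord} :
      SemigroupDeduces E u v → SemigroupDeduces E u' v' → SemigroupDeduces E (u * u') (v * v')

/-- The monoid `M` is finitely based (as a monoid): some finite set of identities of `M` allows
one to deduce every identity of `M`. -/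
def MonoidFinitelyBased (M : Type*) [Monoid M] : Prop :=
  ∃ E : Set (MonoidWord × MonoidWord), E.Finite ∧ (∀ p ∈ E, MonoidSatisfies M p.1 p.2) ∧
    ∀ u v : MonoidWord, MonoidSatisfies M u v → MonoidDeduces E u v

/-- The semigroup `S` is finitely based (as a semigroup). -/
def SemigroupFinitelyBased (S : Type*) [Semigroup S] : Prop :=
  ∃ E : Set (SemigroupWord × SemigroupWord), E.Finite ∧
    (∀ p ∈ E, SemigroupSatisfies S p.1 p.2) ∧
    ∀ u v : SemigroupWord, SemigroupSatisfies S u v → SemigroupDeduces E u v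

/-- The two generators of the Lee monoid. -/
inductive LeeGen : Type
  | a
  | b

/-- The free monoid with zero on the generators `a` and `b`. -/
abbrev LeeFree : Type := WithZero (FreeMonoid LeeGen)

/-- The generators as elements of the free monoid with zero. -/
def leeGen (g : LeeGen) : LeeFree := ((FreeMonoid.of g : FreeMonoid LeeGen) : LeeFree)

/-- The defining relations `aa = a`, `bb = b`, `abab = 0`. -/
inductive LeeRel : LeeFree → LeeFree → Prop
  | idem_a : LeeRel (leeGen LeeGen.a * leeGen LeeGen.a) (leeGen LeeGen.a)
  | idem_b : LeeRel (leeGen LeeGen.b * leeGen LeeGen.b) (leeGen LeeGen.b)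
  | abab : LeeRel (leeGen LeeGen.a * leeGen LeeGen.b * leeGen LeeGen.a * leeGen LeeGen.b) 0

/-- The Lee monoid `⟨a, b, 1 ∣ aa = a, bb = b, abab = 0⟩`: the quotient of the free monoid with
zero on `a`, `b` by the least congruence containing the defining relations. -/
abbrev LeeMonoid : Type := (conGen LeeRel).Quotient

/-!
The proof works with an explicit multiplication table (`LeeNF`). A product of elements of `{1, a, b}`
vanishes there exactly when it has a scattered subword `abab`, so the identities of the Lee monoid
are statements about scattered subwords.

Take letters `y 0, …, y n` and `z 0, …, z (n - 1)`, let `Y` and `Z` be their products, and consider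

  `Y³ Z³ (y 0) (z 0) (y 1) ⋯ (z (n - 1)) (y n) Z`  and
  `Y³ Z³ (y n) (z (n - 1)) ⋯ (y 1) (z 0) (y 0) Z`.

The two words agree on every substitution (`LeeNF.val_ascWord_eq`). In any word `w` with the same
values, sending one `z m` to `a` and some of the `y i` to `b` shows which `z m` occur between the
last `y i` and the last `y j`, namely those with `i ≤ m < j` (`separated_of_val_eq`). This
betweenness forces the last occurrences of the `y i` to be in increasing or in decreasing order
(`Separated.lastBefore_iff_zero_one`).

An identity `p ≈ q` with at most `n` letters cannot pass from one order to the other. Suppose `θ p`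
is a factor of such a `w` containing all last occurrences of the `y i`. By the pigeonhole principle
two of them, those of `y i` and `y j`, lie in the image of the same letter `x`. As `z i` separates
them, `x` occurs only once in `p` (`Separated.notMem_of_lastIn`), since a second copy would produce
the scattered subword `z y z y` for `z = z i` and one `y` of `y i`, `y j`. The identity must then
keep `x` after all other letters whose image contains `y i` or `y j` (`LastIn.of_val_eq`), and so the
order of the last `y i` and `y j` survives (`Separated.exists_lastIn`). Hence no finite set of
identities suffices. The two words are nonempty and a deduction between semigroup words is
also a deduction between monoid words, so the same identities settle both signatures.
-/

/-! ### The multiplication table -/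

/-- Normal forms for the Lee monoid: the alternating words in `a`, `b` without a factor `abab`,
and zero. -/
inductive LeeNF : Type
  | one | a | b | ab | ba | aba | bab | baba | zero
  deriving DecidableEq

namespace LeeNF

instance : Fintype LeeNF where
  elems := {one, a, b, ab, ba, aba, bab, baba, zero}
  complete x := by cases x <;> decide

/-- Right multiplication by the generator `a`. -/
def mulA : LeeNF → LeeNF
  | one => a | a => a | b => ba | ab => aba | ba => ba | aba => aba | bab => baba | baba => baba
  | zero => zero

/-- Right multiplication by the generator `b`. -/
def mulB : LeeNF → LeeNF
  | one => b | a => ab | b => b | ab => ab | ba => bab | aba => zero | bab => bab | baba => zero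
  | zero => zero

/-- The product, obtained by multiplying `x` on the right by the letters of the second factor in
turn. -/
def mul (x : LeeNF) : LeeNF → LeeNF
  | one => x
  | a => x.mulA
  | b => x.mulB
  | ab => x.mulA.mulB
  | ba => x.mulB.mulA
  | aba => x.mulA.mulB.mulA
  | bab => x.mulB.mulA.mulB
  | baba => x.mulB.mulA.mulB.mulA
  | zero => zero

instance : MonoidWithZero LeeNF where
  mul := mul
  one := one
  zero := zero
  mul_assoc := by
    have h : ∀ x y z : LeeNF, mul (mul x y) z = mul x (mul y z) := by decide
    exact h
  one_mul := by
    have h : ∀ x : LeeNF, mul one x = x := by decide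
    exact h
  mul_one _ := rfl
  zero_mul := by
    have h : ∀ x : LeeNF, mul zero x = zero := by decide
    exact h
  mul_zero _ := rfl

/-- The normal form of a generator. -/
def gen : LeeGen → LeeNF
  | .a => a
  | .b => b

/-- The normal form of an element of the free monoid with zero. -/
def eval : LeeFree →* LeeNF :=
  (WithZero.lift' (FreeMonoid.lift gen) : LeeFree →*₀ LeeNF)

theorem eval_zero : eval 0 = 0 := map_zero (WithZero.lift' (FreeMonoid.lift gen))

theorem eval_leeGen (g : LeeGen) : eval (leeGen g) = gen g := by
  simp [eval, leeGen]

theorem conGen_le_ker : conGen LeeRel ≤ Con.ker eval := by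
  refine Con.conGen_le.2 ?_
  rintro _ _ (_ | _ | _) <;> simp only [Con.ker_rel, map_mul, eval_leeGen, eval_zero, gen] <;> decide

/-- The normal form of an element of the Lee monoid. -/
def ofLee : LeeMonoid →* LeeNF := (conGen LeeRel).lift eval conGen_le_ker

/-- The class of `x` in the Lee monoid. -/
abbrev cls (x : LeeFree) : LeeMonoid := (x : (conGen LeeRel).Quotient)

/-- The element of the Lee monoid that a normal form stands for. -/
def toLee : LeeNF → LeeMonoid
  | one => 1
  | a => cls (leeGen .a)
  | b => cls (leeGen .b)
  | ab => cls (leeGen .a) * cls (leeGen .b)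
  | ba => cls (leeGen .b) * cls (leeGen .a)
  | aba => cls (leeGen .a) * cls (leeGen .b) * cls (leeGen .a)
  | bab => cls (leeGen .b) * cls (leeGen .a) * cls (leeGen .b)
  | baba => cls (leeGen .b) * cls (leeGen .a) * cls (leeGen .b) * cls (leeGen .a)
  | zero => cls 0

theorem cls_idem (g : LeeGen) : cls (leeGen g) * cls (leeGen g) = cls (leeGen g) := by
  refine (Con.eq _).2 (.of _ _ ?_)
  cases g
  exacts [.idem_a, .idem_b]

theorem cls_abab :
    cls (leeGen .a) * cls (leeGen .b) * cls (leeGen .a) * cls (leeGen .b) = cls 0 :=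
  (Con.eq _).2 (.of _ _ .abab)

theorem mul_cls_zero (x : LeeFree) : cls x * cls 0 = cls 0 :=
  congrArg cls (mul_zero x)

theorem toLee_mul_gen (x : LeeNF) (g : LeeGen) : toLee (x * gen g) = toLee x * cls (leeGen g) := by
  have ha := cls_idem .a
  have hb := cls_idem .b
  have h0 := cls_abab
  have hz' := mul_cls_zero (leeGen .b)
  cases x <;> cases g <;>
    simp only [gen, show ∀ y : LeeNF, y * a = y.mulA from fun _ => rfl,
      show ∀ y : LeeNF, y * b = y.mulB from fun _ => rfl, mulA, mulB, toLee, one_mul,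
      mul_assoc, ha, hb] at * <;> first | rfl | simp only [h0, hz']

theorem toLee_eval (x : LeeFree) : toLee (eval x) = cls x := by
  induction x using WithZero.recZeroCoe with
  | zero => rw [eval_zero]; rfl
  | coe w =>
    obtain ⟨w, rfl⟩ := FreeMonoid.ofList.surjective w
    induction w using List.reverseRecOn with
    | nil => exact congrArg toLee (map_one eval)
    | append_singleton w g ih =>
      have h : ((FreeMonoid.ofList (w ++ [g]) : FreeMonoid LeeGen) : LeeFree) =
          ((FreeMonoid.ofList w : FreeMonoid LeeGen) : LeeFree) * leeGen g := by
        rw [leeGen, ← WithZero.coe_mul]; rfl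
      rw [h, map_mul, eval_leeGen, toLee_mul_gen, ih]; rfl

/-- The Lee monoid is isomorphic to its monoid of normal forms. -/
noncomputable def leeEquiv : LeeMonoid ≃* LeeNF :=
  MulEquiv.ofBijective ofLee ⟨by
    refine Function.LeftInverse.injective (g := toLee) fun x => ?_
    induction x using Con.induction_on with
    | H x => exact toLee_eval x, by
    have h (g : LeeGen) : ofLee (cls (leeGen g)) = gen g := eval_leeGen g
    intro x
    refine ⟨toLee x, ?_⟩
    cases x <;> simp only [toLee, map_mul, map_one, h]
    case zero => exact eval_zero
    all_goals rfl⟩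

theorem card_leeMonoid : Nat.card LeeMonoid = 9 := by
  rw [Nat.card_congr leeEquiv.toEquiv, Nat.card_eq_fintype_card]; rfl

end LeeNF

/-! ### Values of words and alternating scattered subwords -/

namespace LeeNF

/-- The value of the word `w` when each variable `x` is replaced by `θ x`. -/
def val (θ : ℕ → LeeNF) (w : List ℕ) : LeeNF := (w.map θ).prod

section val
variable (θ : ℕ → LeeNF)

@[simp] theorem val_nil : val θ [] = 1 := rfl

@[simp] theorem val_cons (x : ℕ) (w : List ℕ) : val θ (x :: w) = θ x * val θ w := by simp [val]

@[simp] theorem val_append (v w : List ℕ) : val θ (v ++ w) = val θ v * val θ w := by simp [val]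

end val

theorem mul_mul_eq_zero : ∀ x y m : LeeNF, x * y = 0 → x * m * y = 0 := by decide

/-- The prefix `c` carries the induction; only `c = 1` is used afterwards. -/
theorem mul_val_eq_zero_of_sublist (θ : ℕ → LeeNF) {v w : List ℕ} (h : v.Sublist w) (c : LeeNF)
    (hv : c * val θ v = 0) : c * val θ w = 0 := by
  induction h generalizing c with
  | slnil => exact hv
  | cons x _ ih =>
    rw [val_cons, ← mul_assoc]
    exact ih _ (mul_mul_eq_zero _ _ _ hv)
  | cons_cons x _ ih =>
    rw [val_cons, ← mul_assoc] at hv ⊢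
    exact ih _ hv

theorem val_eq_zero_of_sublist {θ : ℕ → LeeNF} {v w : List ℕ} (h : v.Sublist w)
    (hv : val θ v = 0) : val θ w = 0 := by
  simpa using mul_val_eq_zero_of_sublist θ h 1 (by simpa using hv)

/-- The length of the longest prefix of `abab` that is a scattered subword of the given normal
form. -/
def progress : LeeNF → ℕ
  | one | b => 0
  | a | ba => 1
  | ab | bab => 2
  | aba | baba => 3
  | zero => 4

theorem progress_step : ∀ x g : LeeNF, g = a ∨ g = b → progress (x * g) = progress x ∨
    [a, b, a, b].take (progress (x * g)) = [a, b, a, b].take (progress x) ++ [g] := by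
  decide

/-- A substitution into `{1, a, b}` annihilates `w` only because `w` has a scattered subword that
it sends to `abab`: more generally, the progress of the value is witnessed inside `w`. -/
theorem exists_sublist_progress {θ : ℕ → LeeNF} (hθ : ∀ x, θ x = 1 ∨ θ x = a ∨ θ x = b)
    (w : List ℕ) :
    ∃ v : List ℕ, v.Sublist w ∧ v.map θ = [a, b, a, b].take (progress (val θ w)) := by
  induction w using List.reverseRecOn with
  | nil => exact ⟨[], .slnil, rfl⟩
  | append_singleton w x ih =>
    obtain ⟨v, hv, hm⟩ := ih
    have hw : val θ (w ++ [x]) = val θ w * θ x := by simp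
    rcases hθ x with h | h
    · exact ⟨v, hv.trans (List.sublist_append_left ..), by rw [hw, h, mul_one, hm]⟩
    · rcases progress_step (val θ w) (θ x) h with h' | h'
      · exact ⟨v, hv.trans (List.sublist_append_left ..), by rw [hw, h', hm]⟩
      · exact ⟨v ++ [x], hv.append (.refl _), by rw [hw, h', ← hm]; simp⟩

/-- The substitution sending `z` to `a`, both `y` and `y'` to `b`, and every other variable
to `1`. -/
def assign (z y y' x : ℕ) : LeeNF := if x = z then a else if x = y ∨ x = y' then b else 1

theorem val_assign_eq_zero_iff {z y y' : ℕ} (hy : y ≠ z) (hy' : y' ≠ z) {w : List ℕ} :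
    val (assign z y y') w = 0 ↔ [z, y, z, y].Sublist w ∨ [z, y, z, y'].Sublist w ∨
      [z, y', z, y].Sublist w ∨ [z, y', z, y'].Sublist w := by
  have ez : assign z y y' z = a := by simp [assign]
  have ey : assign z y y' y = b := by simp [assign, hy]
  have ey' : assign z y y' y' = b := by simp [assign, hy']
  have h0 : a * (b * (a * (b * 1))) = (0 : LeeNF) := by decide
  constructor
  · intro h
    obtain ⟨v, hv, hm⟩ := exists_sublist_progress (θ := assign z y y')
      (fun x => by unfold assign; split_ifs <;> simp) w
    have ha {x : ℕ} (hx : assign z y y' x = a) : x = z := by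
      by_contra hxz
      simp only [assign, hxz, if_false] at hx
      split_ifs at hx
    have hb {x : ℕ} (hx : assign z y y' x = b) : x = y ∨ x = y' := by
      unfold assign at hx
      split_ifs at hx with _ h2
      exact h2
    rw [h] at hm
    change v.map _ = [a, b, a, b] at hm
    simp only [List.map_eq_cons_iff, List.map_eq_nil_iff] at hm
    obtain ⟨x1, _, rfl, h1, x2, _, rfl, h2, x3, _, rfl, h3, x4, _, rfl, h4, rfl⟩ := hm
    obtain rfl := ha h1
    obtain rfl := ha h3
    rcases hb h2 with rfl | rfl <;> rcases hb h4 with rfl | rfl <;> simp [hv]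
  · rintro (h | h | h | h) <;> refine val_eq_zero_of_sublist h ?_ <;> simpa [ez, ey, ey'] using h0

end LeeNF

/-! ### The last occurrence of a letter from a set -/

/-- Among all occurrences in `w` of letters from `S`, the last one is an occurrence of `x`. -/
def LastIn (S : Set ℕ) (w : List ℕ) (x : ℕ) : Prop :=
  ∃ w₁ w₂, w = w₁ ++ x :: w₂ ∧ x ∈ S ∧ ∀ t ∈ w₂, t ∉ S

namespace LastIn
variable {S : Set ℕ} {v w : List ℕ} {x y : ℕ}

theorem mem_set (h : LastIn S w x) : x ∈ S := by
  obtain ⟨_, _, _, h, _⟩ := h; exact h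

theorem mem (h : LastIn S w x) : x ∈ w := by
  obtain ⟨_, _, rfl, _⟩ := h; simp

theorem append_left (h : LastIn S w x) (v : List ℕ) : LastIn S (v ++ w) x := by
  obtain ⟨w₁, w₂, rfl, h⟩ := h
  exact ⟨v ++ w₁, w₂, by simp, h⟩

theorem append_right (h : LastIn S w x) (hv : ∀ t ∈ v, t ∉ S) : LastIn S (w ++ v) x := by
  obtain ⟨w₁, w₂, rfl, h, h'⟩ := h
  refine ⟨w₁, w₂ ++ v, by simp, h, fun t ht => ?_⟩
  rcases List.mem_append.1 ht with ht | ht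
  exacts [h' t ht, hv t ht]

theorem exists_of_mem (hx : x ∈ w) (hS : x ∈ S) : ∃ y, LastIn S w y := by
  induction w using List.reverseRecOn with
  | nil => simp at hx
  | append_singleton w t ih =>
    by_cases ht : t ∈ S
    · exact ⟨t, w, [], rfl, ht, by simp⟩
    · have : x ∈ w := by
        rcases List.mem_append.1 hx with h | h
        · exact h
        · rw [List.mem_singleton.1 h] at hS
          exact absurd hS ht
      obtain ⟨y, hy⟩ := ih this
      exact ⟨y, hy.append_right (by simpa using ht)⟩

theorem unique (hx : LastIn S w x) (hy : LastIn S w y) : x = y := by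
  obtain ⟨w₁, w₂, rfl, hx, hw⟩ := hx
  obtain ⟨v₁, v₂, he, hy, hv⟩ := hy
  rcases List.append_eq_append_iff.1 he with ⟨u, rfl, hu⟩ | ⟨u, rfl, hu⟩
  · cases u with
    | nil => simpa using (List.cons.inj hu).1
    | cons t u =>
      have := (List.cons.inj hu).2
      exact absurd hy (hw y (by simp [this]))
  · cases u with
    | nil => simpa using (List.cons.inj hu).1.symm
    | cons t u =>
      have := (List.cons.inj hu).2
      exact absurd hx (hv x (by simp [this]))

/-- The last letter from `S` after a substitution lies in the image of the last letter whose image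
meets `S`. -/
theorem flatMap {θ : ℕ → List ℕ} (hx : LastIn {t | ∃ s ∈ θ t, s ∈ S} w x)
    (hy : LastIn S (θ x) y) : LastIn S (w.flatMap θ) y := by
  obtain ⟨w₁, w₂, rfl, -, hw⟩ := hx
  rw [List.flatMap_append, List.flatMap_cons]
  refine (hy.append_right fun t ht htS => ?_).append_left _
  obtain ⟨s, hs, ht⟩ := List.mem_flatMap.1 ht
  exact hw s hs ⟨t, ht, htS⟩

theorem union {T : Set ℕ} (hS : LastIn S w x) (hT : LastIn T w x) : LastIn (S ∪ T) w x := by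
  obtain ⟨t, ht⟩ := exists_of_mem (S := S ∪ T) hS.mem (.inl hS.mem_set)
  have ht' := ht
  obtain ⟨w₁, w₂, rfl, h, h'⟩ := ht
  rcases h with h | h
  · rwa [hS.unique ⟨w₁, w₂, rfl, h, fun t ht h => h' t ht (.inl h)⟩]
  · rwa [hT.unique ⟨w₁, w₂, rfl, h, fun t ht h => h' t ht (.inr h)⟩]

/-- If the last `x` comes after every `y`, then a scattered subword ending in `y` extends
by `x`. -/
theorem sublist_append (h : LastIn {y, x} w x) (hne : y ≠ x) {l : List ℕ}
    (hl : (l ++ [y]).Sublist w) : (l ++ [y, x]).Sublist w := by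
  obtain ⟨w₁, w₂, rfl, -, h⟩ := h
  obtain ⟨l₁, l₂, he, h₁, h₂⟩ := List.sublist_append_iff.1 hl
  have : l₂ = [] := by
    rcases List.eq_nil_or_concat l₂ with h0 | ⟨l₃, t, rfl⟩
    · exact h0
    · rw [List.concat_eq_append] at h₂ he
      rw [← List.append_assoc] at he
      obtain rfl : y = t := by simpa using (List.append_inj_right' he rfl)
      have := h₂.subset (a := y) (by simp)
      rcases List.mem_cons.1 this with h3 | h3
      · exact absurd h3 hne
      · exact absurd (by simp) (h y h3)
  subst this
  rw [List.append_nil] at he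
  rw [show l ++ [y, x] = (l ++ [y]) ++ [x] by simp, he]
  exact h₁.append (by simp)

end LastIn

/-! ### Words in which the odd letters separate the last occurrences of the even letters -/

/-- The combinatorial content of having the same values as `ascWord n`. The letters are
`y i = 2 * i` for `i ≤ n` and `z m = 2 * m + 1` for `m < n`; the letter `z m` separates `y i` from
`y j` when exactly one of `i`, `j` is at most `m`. With `z m` sent to `a` and `y i`, `y j` sent to
`b`, the word vanishes exactly when `z m` separates them; this is expressed through the scattered
subwords `z y z y'` responsible for a zero. -/
structure Separated (n : ℕ) (w : List ℕ) : Prop where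
  between : ∀ i j m, i ≤ m → m < j → j ≤ n →
    [2 * m + 1, 2 * i, 2 * m + 1, 2 * j].Sublist w ∨
      [2 * m + 1, 2 * j, 2 * m + 1, 2 * i].Sublist w
  outside : ∀ i j m, m < n → (m < i ↔ m < j) →
    ¬ [2 * m + 1, 2 * i, 2 * m + 1, 2 * j].Sublist w

/-- The last occurrence of the letter `2 * i` or `2 * j` is one of `2 * j`. -/
def LastBefore (w : List ℕ) (i j : ℕ) : Prop := LastIn {2 * i, 2 * j} w (2 * j)

theorem LastBefore.not_swap {w : List ℕ} {i j : ℕ} (hne : i ≠ j) (h : LastBefore w i j) :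
    ¬ LastBefore w j i := by
  intro h'
  rw [LastBefore, Set.pair_comm] at h'
  have := h.unique h'
  omega

namespace Separated
variable {n : ℕ} {w : List ℕ}

theorem mem (h : Separated n w) (hn : 0 < n) {i : ℕ} (hi : i ≤ n) : 2 * i ∈ w := by
  rcases Nat.lt_or_ge i n with hlt | hge
  · rcases h.between i n i le_rfl hlt le_rfl with h | h <;> exact h.subset (by simp)
  · obtain rfl : i = n := le_antisymm hi hge
    rcases h.between 0 i 0 le_rfl hn le_rfl with h | h <;> exact h.subset (by simp)

theorem lastBefore_or (h : Separated n w) (hn : 0 < n) {i : ℕ} (hi : i ≤ n) (j : ℕ) :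
    LastBefore w i j ∨ LastBefore w j i := by
  obtain ⟨t, ht⟩ := LastIn.exists_of_mem (S := {2 * i, 2 * j}) (h.mem hn hi) (by simp)
  rcases ht.mem_set with rfl | rfl
  · right; rwa [LastBefore, Set.pair_comm]
  · exact .inl ht

/-- If `z m` separates `y i` from both `y j` and `y k`, but not `y j` from `y k`, then the last
`y i` is not between the last `y j` and the last `y k`. -/
theorem not_middle (h : Separated n w) {i j k m : ℕ} (hi : i ≤ n) (hj : j ≤ n) (hk : k ≤ n)
    (hm : m < n) (hij : ¬ (m < i ↔ m < j)) (hjk : m < j ↔ m < k) :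
    ¬ (LastBefore w j i ∧ LastBefore w i k) := by
  rintro ⟨hji, hik⟩
  have hne : ∀ {x y : ℕ}, x ≠ y → 2 * x ≠ 2 * y := by intros; omega
  have hpat : [2 * m + 1, 2 * i, 2 * m + 1, 2 * j].Sublist w ∨
      [2 * m + 1, 2 * j, 2 * m + 1, 2 * i].Sublist w := by
    rcases lt_or_ge m i with h' | h'
    · exact (h.between j i m (by omega) h' hi).symm
    · exact h.between i j m h' (by omega) hj
  rcases hpat with hp | hp
  · have := LastIn.sublist_append (x := 2 * i) (y := 2 * j) hji (hne (by rintro rfl; simp at hij))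
      (l := [2 * m + 1, 2 * i, 2 * m + 1]) hp
    exact h.outside i i m hm Iff.rfl (.trans (by simp) this)
  · have := LastIn.sublist_append (x := 2 * k) (y := 2 * i) hik
      (hne (by rintro rfl; exact hij hjk.symm)) (l := [2 * m + 1, 2 * j, 2 * m + 1]) hp
    exact h.outside j k m hm hjk (.trans (by simp) this)

theorem lastBefore_iff (h : Separated n w) {i j k m : ℕ} (hi : i ≤ n) (hj : j ≤ n) (hk : k ≤ n)
    (hm : m < n) (hij : ¬ (m < i ↔ m < j)) (hjk : m < j ↔ m < k) :
    LastBefore w i j ↔ LastBefore w i k := by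
  have key : ∀ {j k : ℕ}, j ≤ n → k ≤ n → ¬ (m < i ↔ m < j) → (m < j ↔ m < k) →
      LastBefore w i j → LastBefore w i k := by
    intro j k hj hk hij hjk hl
    rcases h.lastBefore_or (by omega) hi k with h' | h'
    · exact h'
    · exact absurd ⟨h', hl⟩ (h.not_middle hi hk hj hm (by rwa [← hjk]) hjk.symm)
  exact ⟨key hj hk hij hjk, key hk hj (by rwa [← hjk]) hjk.symm⟩

/-- The last occurrences of the letters `y 0, …, y n` are in increasing or in decreasing order, so a
single comparison decides all of them. -/
theorem lastBefore_iff_zero_one (h : Separated n w) {i j : ℕ} (hij : i < j) (hj : j ≤ n) :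
    LastBefore w i j ↔ LastBefore w 0 1 := by
  have h01 : LastBefore w 0 j ↔ LastBefore w 0 1 :=
    h.lastBefore_iff (m := 0) (by omega) hj (by omega) (by omega) (by omega) (by omega)
  rw [← h01]
  rcases Nat.eq_zero_or_pos i with rfl | hi
  · rfl
  have h1 : LastBefore w j i ↔ LastBefore w j 0 :=
    h.lastBefore_iff (m := i) hj (by omega) (by omega) (by omega) (by omega) (by omega)
  have hn : 0 < n := by omega
  constructor
  · intro h'
    exact (h.lastBefore_or hn (by omega) j).resolve_right fun h0 =>
      (h1.2 h0).not_swap (by omega) h'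
  · intro h'
    exact (h.lastBefore_or hn (by omega) j).resolve_right fun h0 =>
      (h1.1 h0).not_swap (by omega) h'

end Separated

/-! ### Substituting into an identity with few letters -/

open LeeNF in
/-- The two sides of an identity contain the same letters. -/
theorem LeeNF.mem_iff_of_val_eq {p q : List ℕ} (h : ∀ θ, val θ p = val θ q) (x : ℕ) :
    x ∈ p ↔ x ∈ q := by
  classical
  have key : ∀ w : List ℕ, val (fun t => if t = x then 0 else 1) w = 0 ↔ x ∈ w := by
    intro w
    induction w with
    | nil => simp
    | cons t w ih =>
      by_cases ht : t = x
      · simp [ht]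
      · simp [ht, Ne.symm ht, ih]
  rw [← key, h, key]

open LeeNF in
/-- If `x` occurs only once in `p`, and it is the last letter from `T` there, then it is the last
letter from `T` on the other side of the identity: sending `x` to `a` and the rest of `T` to `b`
gives `p` the value `a` or `ba`, and neither is of the form `m * b`. -/
theorem LastIn.of_val_eq {p q : List ℕ} (h : ∀ θ, val θ p = val θ q) {T : Set ℕ} {x : ℕ}
    {p₁ p₂ : List ℕ} (hp : p = p₁ ++ x :: p₂) (hx : x ∈ T) (hp₁ : x ∉ p₁)
    (hp₂ : ∀ t ∈ p₂, t ∉ T) : LastIn T q x := by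
  classical
  obtain ⟨y, hy⟩ := LastIn.exists_of_mem (S := T) (w := q) (x := x)
    ((mem_iff_of_val_eq h x).1 (by simp [hp])) hx
  by_contra hne
  have hyx : y ≠ x := by rintro rfl; exact hne hy
  let θ : ℕ → LeeNF := fun t => if t = x then a else if t ∈ T then b else 1
  have h₁ : val θ p₁ = 1 ∨ val θ p₁ = b := by
    clear hp
    induction p₁ with
    | nil => exact .inl rfl
    | cons t p₁ ih =>
      have htx : t ≠ x := by rintro rfl; simp at hp₁
      rw [val_cons]
      have ht : θ t = 1 ∨ θ t = b := by
        simp only [θ, if_neg htx]; split_ifs <;> simp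
      rcases ih (fun h => hp₁ (by simp [h])) with h | h <;> rcases ht with h' | h' <;>
        rw [h, h'] <;> decide
  have h₂ : ∀ v : List ℕ, (∀ t ∈ v, t ∉ T) → val θ v = 1 := by
    intro v hv
    induction v with
    | nil => rfl
    | cons t v ih =>
      have htT := hv t (by simp)
      have htx : t ≠ x := by rintro rfl; exact htT hx
      rw [val_cons, ih fun s hs => hv s (by simp [hs])]
      simp [θ, htx, htT]
  obtain ⟨q₁, q₂, rfl, hyT, hq⟩ := hy
  have e := h θ
  have hθx : θ x = a := by simp [θ]
  have hθy : θ y = b := by simp [θ, hyx, hyT]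
  rw [hp] at e
  simp only [val_append, val_cons, h₂ _ hp₂, h₂ _ hq, hθx, hθy, mul_one] at e
  have hd : ∀ m : LeeNF, 1 * a ≠ m * b ∧ b * a ≠ m * b := by decide
  rcases h₁ with h₁ | h₁ <;> rw [h₁] at e
  exacts [(hd _).1 e, (hd _).2 e]

/-- A letter `x` whose image under the substitution contains the last occurrences of two letters
`y i`, `y j` with `i < j` has no earlier occurrence. Since `z i` separates `y i` from `y j`, its
image has a scattered subword `z i, y i` or `z i, y j`, which a second copy would turn
into `z y z y`. -/
theorem Separated.notMem_of_lastIn {n : ℕ} {θ : ℕ → List ℕ} {p₁ p₂ α β : List ℕ} {x i j : ℕ}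
    (h : Separated n (α ++ (p₁ ++ x :: p₂).flatMap θ ++ β)) (hij : i < j) (hj : j ≤ n)
    (hi' : 2 * i ∈ θ x) (hj' : 2 * j ∈ θ x)
    (hi₂ : 2 * i ∉ p₂.flatMap θ ++ β) (hj₂ : 2 * j ∉ p₂.flatMap θ ++ β) : x ∉ p₁ := by
  intro hx
  have hw : α ++ (p₁ ++ x :: p₂).flatMap θ ++ β =
      ((α ++ p₁.flatMap θ) ++ θ x) ++ (p₂.flatMap θ ++ β) := by simp
  have key : ∀ k l, 2 * k ∈ θ x → 2 * l ∉ p₂.flatMap θ ++ β →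
      ¬ [2 * i + 1, 2 * k, 2 * i + 1, 2 * l].Sublist
        (α ++ (p₁ ++ x :: p₂).flatMap θ ++ β) := by
    intro k l hkx hl₂ hs
    rw [hw] at hs
    -- The final `y l` cannot come from the part after `θ x`.
    have hs' : [2 * i + 1, 2 * k, 2 * i + 1, 2 * l].Sublist ((α ++ p₁.flatMap θ) ++ θ x) := by
      obtain ⟨l₁, l₂, he, h₁, h₂⟩ := List.sublist_append_iff.1 hs
      rcases List.eq_nil_or_concat l₂ with rfl | ⟨l₃, t, rfl⟩
      · rw [he]; simpa using h₁
      · rw [List.concat_eq_append] at h₂ he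
        rw [← List.append_assoc] at he
        have : 2 * l = t := by
          simpa using List.append_inj_right' (s₁ := [2 * i + 1, 2 * k, 2 * i + 1]) he rfl
        exact absurd (h₂.subset (by simp [this])) hl₂
    obtain ⟨l₁, l₂, he, h₁, h₂⟩ := List.sublist_append_iff.1 hs'
    -- Whatever `θ x` contains occurs twice in the word, as `x` occurs twice.
    have hin : ∀ {v : List ℕ}, v.Sublist (θ x) → (v ++ v).Sublist
        (α ++ (p₁ ++ x :: p₂).flatMap θ ++ β) := by
      intro v hv
      rw [hw]
      refine .trans (.append (.trans ?_ (List.sublist_append_right ..)) hv)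
        (List.sublist_append_left ..)
      obtain ⟨u, u', rfl⟩ := List.append_of_mem hx
      exact hv.trans (by simp)
    have hcase : [2 * i + 1, 2 * k, 2 * i + 1].Sublist l₁ ∨ [2 * i + 1, 2 * l].Sublist l₂ := by
      match l₁, he with
      | [], he => right; rw [← List.nil_append l₂, ← he]; simp
      | [_], he => right; simp at he; simp [← he]
      | [_, _], he => right; simp at he; simp [← he]
      | _ :: _ :: _ :: _, he => left; simp at he; simp [← he]
    rcases hcase with hc | hc
    · refine h.outside k k i (by omega) Iff.rfl ?_
      rw [hw]
      exact .trans ((hc.trans h₁).append (List.singleton_sublist.2 hkx))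
        (List.sublist_append_left ..)
    · exact h.outside l l i (by omega) Iff.rfl (hin (hc.trans h₂))
  rcases h.between i j i le_rfl hij hj with hp | hp
  · exact key i j hi' hj₂ hp
  · exact key j i hj' hi₂ hp

open LeeNF in
/-- Applying an identity with at most `n` letters to a separated word leaves the order of the last
occurrences of some pair `y i`, `y j` unchanged. If all these last occurrences lie in the part being
rewritten, then by the pigeonhole principle two of them lie in the image of the same letter. -/
theorem Separated.exists_lastIn {n : ℕ} (hn : 0 < n) {p q : List ℕ} (hpq : ∀ θ, val θ p = val θ q)
    (hlen : p.length ≤ n) (θ : ℕ → List ℕ) {α β : List ℕ}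
    (h : Separated n (α ++ p.flatMap θ ++ β)) :
    ∃ i j, i < j ∧ j ≤ n ∧ ∃ t, LastIn {2 * i, 2 * j} (α ++ p.flatMap θ ++ β) t ∧
      LastIn {2 * i, 2 * j} (α ++ q.flatMap θ ++ β) t := by
  have hmem (x : ℕ) : x ∈ p.flatMap θ ↔ x ∈ q.flatMap θ := by
    simp only [List.mem_flatMap, mem_iff_of_val_eq hpq]
  have hwlog : (∃ i ≤ n, ∃ j ≤ n, i ≠ j ∧ ∃ t, LastIn {2 * i, 2 * j} (α ++ p.flatMap θ ++ β) t ∧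
      LastIn {2 * i, 2 * j} (α ++ q.flatMap θ ++ β) t) → ∃ i j, i < j ∧ j ≤ n ∧
      ∃ t, LastIn {2 * i, 2 * j} (α ++ p.flatMap θ ++ β) t ∧
        LastIn {2 * i, 2 * j} (α ++ q.flatMap θ ++ β) t := by
    rintro ⟨i, hi, j, hj, hne, ht⟩
    rcases lt_or_gt_of_ne hne with hl | hl
    · exact ⟨i, j, hl, hj, ht⟩
    · exact ⟨j, i, hl, hi, by rwa [Set.pair_comm]⟩
  have hother : ∀ i, ∃ j ≤ n, i ≠ j := fun i => by
    rcases Nat.eq_zero_or_pos i with rfl | hi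
    exacts [⟨1, hn, by omega⟩, ⟨0, by omega, by omega⟩]
  by_cases hβ : ∃ i ≤ n, 2 * i ∈ β
  · obtain ⟨i, hi, hiβ⟩ := hβ
    obtain ⟨j, hj, hij⟩ := hother i
    obtain ⟨t, ht⟩ := LastIn.exists_of_mem (S := {2 * i, 2 * j}) hiβ (by simp)
    exact hwlog ⟨i, hi, j, hj, hij, t, ht.append_left _, ht.append_left _⟩
  push Not at hβ
  have hβ' : ∀ i ≤ n, ∀ j ≤ n, ∀ t ∈ β, t ∉ ({2 * i, 2 * j} : Set ℕ) := by
    rintro i hi j hj t ht (rfl | rfl)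
    exacts [hβ i hi ht, hβ j hj ht]
  by_cases hθ : ∃ i ≤ n, 2 * i ∉ p.flatMap θ
  · obtain ⟨i, hi, hiθ⟩ := hθ
    obtain ⟨j, hj, hij⟩ := hother i
    refine hwlog ⟨i, hi, j, hj, hij, ?_⟩
    by_cases hjθ : 2 * j ∈ p.flatMap θ
    · have key : ∀ v : List ℕ, 2 * i ∉ v → 2 * j ∈ v → LastIn {2 * i, 2 * j} v (2 * j) := by
        intro v hiv hjv
        obtain ⟨t, ht⟩ := LastIn.exists_of_mem (S := {2 * i, 2 * j}) hjv (by simp)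
        rcases ht.mem_set with rfl | rfl
        exacts [absurd ht.mem hiv, ht]
      refine ⟨2 * j, ((key _ hiθ hjθ).append_left _).append_right (hβ' i hi j hj),
        ((key _ ?_ ?_).append_left _).append_right (hβ' i hi j hj)⟩
      · rwa [← hmem]
      · rwa [← hmem]
    · have hα : 2 * i ∈ α := by
        have := h.mem hn hi
        simp only [List.mem_append, hiθ, hβ i hi, or_false] at this
        exact this
      obtain ⟨t, ht⟩ := LastIn.exists_of_mem (S := {2 * i, 2 * j}) hα (by simp)
      refine ⟨t, (ht.append_right ?_).append_right (hβ' i hi j hj),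
        (ht.append_right ?_).append_right (hβ' i hi j hj)⟩
      · rintro t ht (rfl | rfl)
        exacts [hiθ ht, hjθ ht]
      · rintro t ht (rfl | rfl)
        exacts [hiθ ((hmem _).2 ht), hjθ ((hmem _).2 ht)]
  push Not at hθ
  have hex : ∀ i ≤ n, ∃ x, LastIn {t | 2 * i ∈ θ t} p x := fun i hi => by
    obtain ⟨x, hx, hix⟩ := List.mem_flatMap.1 (hθ i hi)
    exact LastIn.exists_of_mem hx hix
  choose! f hf using hex
  -- There are `n + 1` letters `y i`, but at most `n` letters in `p`.
  obtain ⟨i, hi, j, hj, hij, hfij⟩ : ∃ i ∈ Finset.range (n + 1), ∃ j ∈ Finset.range (n + 1),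
      i ≠ j ∧ f i = f j := by
    refine Finset.exists_ne_map_eq_of_card_lt_of_maps_to (t := p.toFinset) ?_ fun i hi => ?_
    · rw [Finset.card_range]
      exact Nat.lt_succ_of_le ((List.toFinset_card_le p).trans hlen)
    · exact List.mem_toFinset.2 (hf i (Nat.lt_succ_iff.1 (Finset.mem_range.1 hi))).mem
  rw [Finset.mem_range, Nat.lt_succ_iff] at hi hj
  obtain ⟨i, j, hij, hj, hfij⟩ : ∃ i j, i < j ∧ j ≤ n ∧ f i = f j := by
    rcases lt_or_gt_of_ne hij with hl | hl
    exacts [⟨i, j, hl, hj, hfij⟩, ⟨j, i, hl, hi, hfij.symm⟩]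
  have hi : i ≤ n := by omega
  refine ⟨i, j, hij, hj, ?_⟩
  have hxi := hf i hi
  have hxj := hf j hj
  rw [← hfij] at hxj
  set x := f i
  have hT : {t | ∃ s ∈ θ t, s ∈ ({2 * i, 2 * j} : Set ℕ)} =
      {t | 2 * i ∈ θ t} ∪ {t | 2 * j ∈ θ t} := by
    ext t
    simp only [Set.mem_ofPred_eq, Set.mem_insert_iff, Set.mem_singleton_iff, Set.mem_union]
    constructor
    · rintro ⟨s, hs, rfl | rfl⟩
      exacts [.inl hs, .inr hs]
    · rintro (hs | hs)
      exacts [⟨_, hs, .inl rfl⟩, ⟨_, hs, .inr rfl⟩]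
  have hp := hxi.union hxj
  rw [← hT] at hp
  obtain ⟨t, ht⟩ := LastIn.exists_of_mem (S := {2 * i, 2 * j}) hxi.mem_set (by simp)
  have hq : LastIn {t | ∃ s ∈ θ t, s ∈ ({2 * i, 2 * j} : Set ℕ)} q x := by
    obtain ⟨p₁, p₂, he, hx, hp₂⟩ := hp
    refine LastIn.of_val_eq hpq he hx ?_ hp₂
    rw [he] at h
    refine h.notMem_of_lastIn hij hj hxi.mem_set hxj.mem_set ?_ ?_ <;>
      rw [List.mem_append, not_or, List.mem_flatMap]
    · exact ⟨fun ⟨s, hs, hs'⟩ => hp₂ s hs ⟨_, hs', by simp⟩, hβ i hi⟩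
    · exact ⟨fun ⟨s, hs, hs'⟩ => hp₂ s hs ⟨_, hs', by simp⟩, hβ j hj⟩
  exact ⟨t, ((hp.flatMap ht).append_left _).append_right (hβ' i hi j hj),
    ((hq.flatMap ht).append_left _).append_right (hβ' i hi j hj)⟩

/-! ### The two words -/

/-- The word `y 0 ⋯ y n`, where `y i = 2 * i`. -/
def evens (n : ℕ) : List ℕ := (List.range (n + 1)).map (2 * ·)

/-- The word `z 0 ⋯ z (n - 1)`, where `z m = 2 * m + 1`. -/
def odds (n : ℕ) : List ℕ := (List.range n).map (2 * · + 1)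

/-- The context `Y³ Z³ _ Z` around a word, where `Y` and `Z` are the products of the letters `y i`
and `z m`. The cubes vanish unless the values of the `y i`, and those of the `z m`, lie in
`{1, a}` or in `{1, b}`. -/
def wrap (n : ℕ) (w : List ℕ) : List ℕ :=
  evens n ++ evens n ++ evens n ++ (odds n ++ odds n ++ odds n) ++ (w ++ odds n)

/-- The word `Y³ Z³ (y 0) (z 0) (y 1) (z 1) ⋯ (z (n - 1)) (y n) Z`. -/
def ascWord (n : ℕ) : List ℕ := wrap n (List.range (2 * n + 1))

/-- The word obtained from `ascWord n` by reversing its middle part. -/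
def descWord (n : ℕ) : List ℕ := wrap n (List.range (2 * n + 1)).reverse

theorem mem_evens {n x : ℕ} : x ∈ evens n ↔ ∃ i ≤ n, x = 2 * i := by
  simp [evens, eq_comm]

theorem mem_odds {n x : ℕ} : x ∈ odds n ↔ ∃ i < n, x = 2 * i + 1 := by
  simp [odds, eq_comm]

theorem mem_evens_or_mem_odds {n x : ℕ} (hx : x ∈ List.range (2 * n + 1)) :
    x ∈ evens n ∨ x ∈ odds n := by
  rw [List.mem_range] at hx
  rcases Nat.even_or_odd' x with ⟨i, rfl | rfl⟩
  · exact .inl (mem_evens.2 ⟨i, by omega, rfl⟩)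
  · exact .inr (mem_odds.2 ⟨i, by omega, rfl⟩)

namespace LeeNF

theorem val_wrap (θ : ℕ → LeeNF) (n : ℕ) (w : List ℕ) : val θ (wrap n w) =
    val θ (evens n) * val θ (evens n) * val θ (evens n) *
      (val θ (odds n) * val θ (odds n) * val θ (odds n)) * (val θ w * val θ (odds n)) := by
  simp only [wrap, val_append]

theorem val_mem_pair {θ : ℕ → LeeNF} {g : LeeNF} (hg : g = a ∨ g = b) {w : List ℕ}
    (h : ∀ x ∈ w, θ x = 1 ∨ θ x = g) : val θ w = 1 ∨ val θ w = g := by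
  have hgg : g * g = g := by rcases hg with rfl | rfl <;> rfl
  induction w with
  | nil => exact .inl rfl
  | cons x w ih =>
    rw [val_cons]
    rcases h x (by simp) with hx | hx <;> rcases ih fun t ht => h t (by simp [ht]) with hw | hw <;>
      simp [hx, hw, hgg]

theorem eq_one_or_of_mul : ∀ x y g : LeeNF, (g = 1 ∨ g = a ∨ g = b) → x * y = g →
    (x = 1 ∨ x = g) ∧ (y = 1 ∨ y = g) := by decide

theorem eq_one_or_of_val {θ : ℕ → LeeNF} {g : LeeNF} (hg : g = 1 ∨ g = a ∨ g = b) {w : List ℕ}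
    (h : val θ w = g) : ∀ x ∈ w, θ x = 1 ∨ θ x = g := by
  have key : ∀ w : List ℕ, (val θ w = 1 ∨ val θ w = g) → ∀ x ∈ w, θ x = 1 ∨ θ x = g := by
    intro w
    induction w with
    | nil => simp
    | cons x w ih =>
      intro h
      have hd : (θ x = 1 ∨ θ x = g) ∧ (val θ w = 1 ∨ val θ w = g) := by
        rcases h with h | h
        · obtain ⟨h1, h2⟩ := eq_one_or_of_mul _ _ _ (.inl rfl) h
          exact ⟨.inl (or_self_iff.1 h1), .inl (or_self_iff.1 h2)⟩
        · exact eq_one_or_of_mul _ _ _ hg h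
      intro t ht
      rcases List.mem_cons.1 ht with rfl | ht
      exacts [hd.1, ih hd.2 t ht]
  exact key w (.inr h)

theorem cube_eq_zero : ∀ x : LeeNF, (x = 1 ∨ x = a ∨ x = b) ∨ x * x * x = 0 := by decide

/-- The pairs of values that a word over `{1, a, b}` and its reversal can take together. -/
def Mirror (x y : LeeNF) : Prop :=
  (x, y) ∈ [(1, 1), (a, a), (b, b), (ab, ba), (ba, ab), (aba, aba), (bab, bab), (baba, 0),
    (0, baba), (0, 0)]

instance (x y : LeeNF) : Decidable (Mirror x y) := by unfold Mirror; infer_instance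

theorem Mirror.mul : ∀ x y : LeeNF, Mirror x y → ∀ g : LeeNF, (g = 1 ∨ g = a ∨ g = b) →
    Mirror (g * x) (y * g) := by decide

theorem mirror_val {θ : ℕ → LeeNF} {w : List ℕ} (h : ∀ x ∈ w, θ x = 1 ∨ θ x = a ∨ θ x = b) :
    Mirror (val θ w) (val θ w.reverse) := by
  induction w with
  | nil => exact (by decide : Mirror 1 1)
  | cons x w ih =>
    rw [List.reverse_cons, val_append, val_cons, val_cons, val_nil, mul_one]
    exact (ih fun t ht => h t (by simp [ht])).mul _ _ _ (h x (by simp))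

theorem Mirror.sandwich : ∀ x y : LeeNF, Mirror x y → a * (x * a) = a * (y * a) ∧
    b * (x * b) = b * (y * b) := by decide

theorem Mirror.eq_of_left : ∀ x y : LeeNF, Mirror x y → (x = 1 ∨ x = a ∨ x = b) → x = y := by
  decide

/-- The identity `ascWord n ≈ descWord n` holds. Unless a cube in the context vanishes, the following
alternative applies. If some `z m` is not sent to `1`, the middle part stands between two copies of
`a` or two copies of `b`, where it may be reversed; otherwise it is a power of a single generator. -/
theorem val_ascWord_eq (n : ℕ) (θ : ℕ → LeeNF) : val θ (ascWord n) = val θ (descWord n) := by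
  rw [ascWord, descWord, val_wrap, val_wrap]
  rcases cube_eq_zero (val θ (evens n)) with hE | hE
  swap
  · rw [hE, zero_mul, zero_mul, zero_mul]
  rcases cube_eq_zero (val θ (odds n)) with hO | hO
  swap
  · rw [hO, mul_zero, zero_mul, zero_mul]
  have hE' := eq_one_or_of_val hE rfl
  have hO' := eq_one_or_of_val hO rfl
  have hM : Mirror (val θ (List.range (2 * n + 1))) (val θ (List.range (2 * n + 1)).reverse) := by
    refine mirror_val fun x hx => ?_
    rcases mem_evens_or_mem_odds hx with hx | hx
    · rcases hE' x hx with h | h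
      exacts [.inl h, h ▸ hE]
    · rcases hO' x hx with h | h
      exacts [.inl h, h ▸ hO]
  rcases hO with hO | hO | hO
  · suffices h : val θ (List.range (2 * n + 1)) = 1 ∨ val θ (List.range (2 * n + 1)) = a ∨
        val θ (List.range (2 * n + 1)) = b by rw [hM.eq_of_left _ _ h]
    have hR : ∀ x ∈ List.range (2 * n + 1), θ x = 1 ∨ θ x = val θ (evens n) := fun x hx => by
      rcases mem_evens_or_mem_odds hx with hx | hx
      · exact hE' x hx
      · exact .inl (or_self_iff.1 (hO ▸ hO' x hx))
    rcases hE with hE | hE | hE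
    · rw [hE] at hR
      exact (val_mem_pair (.inl rfl) fun x hx => .inl (or_self_iff.1 (hR x hx))).imp_right .inl
    · rw [hE] at hR
      exact (val_mem_pair (.inl rfl) hR).imp_right .inl
    · rw [hE] at hR
      exact (val_mem_pair (.inr rfl) hR).imp_right .inr
  · have haa : a * a = a := rfl
    simp only [hO, haa]
    rw [mul_assoc _ a, mul_assoc _ a, (hM.sandwich _ _).1]
  · have hbb : b * b = b := rfl
    simp only [hO, hbb]
    rw [mul_assoc _ b, mul_assoc _ b, (hM.sandwich _ _).2]

/-- In the context `Y³ Z³ _ Z`, with `Y` over `{1, b}` and `Z` over `{1, a}`, a middle part with at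
most one change of letter does not give zero. -/
theorem blocks_ne_zero : ∀ e ∈ [1, b], ∀ o ∈ [1, a], ∀ u ∈ [1, a], ∀ v ∈ [1, b],
    e * e * e * (o * o * o) * (u * v * o) ≠ (0 : LeeNF) ∧
      e * e * e * (o * o * o) * (v * u * o) ≠ (0 : LeeNF) := by decide

end LeeNF

open LeeNF

theorem val_ascWord_ne_zero {n i j m : ℕ} (hm : m < n) (hij : m < i ↔ m < j) :
    val (assign (2 * m + 1) (2 * i) (2 * j)) (ascWord n) ≠ 0 := by
  set θ := assign (2 * m + 1) (2 * i) (2 * j) with hθ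
  have hne {x : ℕ} (hx : x ≠ 2 * m + 1) : θ x = 1 ∨ θ x = b := by
    simp only [hθ, assign, if_neg hx]; split_ifs <;> simp
  have hne' {x : ℕ} (hx : x ≠ 2 * i) (hx' : x ≠ 2 * j) : θ x = 1 ∨ θ x = a := by
    simp only [hθ, assign, hx, hx', or_self, if_false]; split_ifs <;> simp
  have hE : val θ (evens n) ∈ [1, b] := by
    simpa using val_mem_pair (.inr rfl) fun x hx => hne (by
      obtain ⟨k, -, rfl⟩ := mem_evens.1 hx; omega)
  have hO : val θ (odds n) ∈ [1, a] := by
    simpa using val_mem_pair (.inl rfl) fun x hx => by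
      obtain ⟨k, -, rfl⟩ := mem_odds.1 hx; exact hne' (by omega) (by omega)
  rw [ascWord, val_wrap]
  -- Both `2 * i` and `2 * j` are on the same side of `2 * m + 1`, so the middle part splits into a
  -- factor over `{1, a}` and a factor over `{1, b}`.
  by_cases hmi : m < i
  · have hmj := hij.1 hmi
    rw [show 2 * n + 1 = (2 * m + 2) + (2 * n + 1 - (2 * m + 2)) by omega, List.range_add,
      val_append]
    refine (blocks_ne_zero _ hE _ hO _ ?_ _ ?_).1
    · simpa using val_mem_pair (.inl rfl) fun x hx => by
        rw [List.mem_range] at hx; exact hne' (by omega) (by omega)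
    · simpa using val_mem_pair (.inr rfl) fun x hx => by
        obtain ⟨k, -, rfl⟩ := List.mem_map.1 hx; exact hne (by omega)
  · have hmj := mt hij.2 hmi
    rw [show 2 * n + 1 = (2 * m + 1) + (2 * n + 1 - (2 * m + 1)) by omega, List.range_add,
      val_append]
    refine (blocks_ne_zero _ hE _ hO _ ?_ _ ?_).2
    · simpa using val_mem_pair (.inl rfl) fun x hx => by
        obtain ⟨k, -, rfl⟩ := List.mem_map.1 hx; exact hne' (by omega) (by omega)
    · simpa using val_mem_pair (.inr rfl) fun x hx => by
        rw [List.mem_range] at hx; exact hne (by omega)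

theorem sublist_ascWord {n i j m : ℕ} (hi : i ≤ m) (hm : m < j) (hj : j ≤ n) :
    [2 * m + 1, 2 * i, 2 * m + 1, 2 * j].Sublist (ascWord n) := by
  have hR : [2 * i, 2 * m + 1, 2 * j].Sublist (List.range (2 * n + 1)) := by
    rw [show 2 * n + 1 = (2 * m + 1) + (1 + (2 * n - (2 * m + 1))) by omega,
      List.range_add (n := 2 * m + 1), List.range_add (n := 1), List.map_append]
    refine .append (l₁ := [2 * i]) (List.singleton_sublist.2 (List.mem_range.2 (by omega)))
      (.append (l₁ := [2 * m + 1]) (by simp) (List.singleton_sublist.2 ?_))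
    simp only [List.map_map, List.mem_map, List.mem_range, Function.comp_apply]
    exact ⟨2 * j - (2 * m + 2), by omega, by omega⟩
  have hO : [2 * m + 1].Sublist (odds n) :=
    List.singleton_sublist.2 (mem_odds.2 ⟨m, by omega, rfl⟩)
  exact .append (l₁ := [2 * m + 1]) ((hO.trans (List.sublist_append_right ..)).trans
    (List.sublist_append_right ..)) (hR.trans (List.sublist_append_left ..))

theorem separated_of_val_eq {n : ℕ} {w : List ℕ} (h : ∀ θ, val θ w = val θ (ascWord n)) :
    Separated n w := by
  have hout : ∀ i j m, m < n → (m < i ↔ m < j) →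
      ¬ [2 * m + 1, 2 * i, 2 * m + 1, 2 * j].Sublist w := fun i j m hm hij hs =>
    val_ascWord_ne_zero hm hij <| by
      rw [← h]
      exact (val_assign_eq_zero_iff (by omega) (by omega)).2 (.inr (.inl hs))
  refine ⟨fun i j m hi hm hj => ?_, hout⟩
  have h0 : val (assign (2 * m + 1) (2 * i) (2 * j)) w = 0 := by
    rw [h]
    exact (val_assign_eq_zero_iff (by omega) (by omega)).2 (.inr (.inl (sublist_ascWord hi hm hj)))
  rcases (val_assign_eq_zero_iff (by omega) (by omega)).1 h0 with h' | h' | h' | h'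
  · exact absurd h' (hout i i m (by omega) Iff.rfl)
  · exact .inl h'
  · exact .inr h'
  · exact absurd h' (hout j j m (by omega) Iff.rfl)

theorem lastIn_wrap {n i j t : ℕ} {w : List ℕ} (h : LastIn {2 * i, 2 * j} w t) :
    LastIn {2 * i, 2 * j} (wrap n w) t :=
  (h.append_right fun x hx hx' => by
    obtain ⟨k, -, rfl⟩ := mem_odds.1 hx
    rcases hx' with hx' | hx'
    · omega
    · rw [Set.mem_singleton_iff] at hx'; omega).append_left _

theorem lastBefore_ascWord {n : ℕ} (hn : 0 < n) : LastBefore (ascWord n) 0 1 := by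
  refine lastIn_wrap ⟨[0, 1], (List.range (2 * n - 2)).map (3 + ·), ?_, by simp, ?_⟩
  · rw [show 2 * n + 1 = 3 + (2 * n - 2) by omega, List.range_add]
    rfl
  · simp only [List.mem_map]
    rintro _ ⟨t, -, rfl⟩ (h | h)
    · omega
    · rw [Set.mem_singleton_iff] at h; omega

theorem lastBefore_descWord {n : ℕ} : LastBefore (descWord n) 1 0 := by
  refine lastIn_wrap ⟨((List.range (2 * n)).map Nat.succ).reverse, [], ?_, by simp, by simp⟩
  rw [List.range_succ_eq_map, List.reverse_cons]

/-! ### No finite basis -/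

/-- Consequences of short identities do not change the order of the last `y 0` and the last `y 1`
in a word with the same values as `ascWord n`. Quantifying over the contexts `α`, `β` makes the
property a congruence. -/
theorem MonoidDeduces.lastBefore_iff {n : ℕ} (hn : 0 < n) {E : Set (MonoidWord × MonoidWord)}
    (hE : ∀ p ∈ E, ∀ θ : ℕ → LeeNF, val θ p.1.toList = val θ p.2.toList)
    (hlen : ∀ p ∈ E, p.1.toList.length ≤ n) {u v : MonoidWord} (h : MonoidDeduces E u v) :
    (∀ θ, val θ u.toList = val θ v.toList) ∧ ∀ α β : List ℕ,
      (∀ θ, val θ (α ++ u.toList ++ β) = val θ (ascWord n)) →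
      (LastBefore (α ++ u.toList ++ β) 0 1 ↔ LastBefore (α ++ v.toList ++ β) 0 1) := by
  have hcongr {u v α β : List ℕ} (h : ∀ θ, val θ u = val θ v)
      (hu : ∀ θ, val θ (α ++ u ++ β) = val θ (ascWord n)) (θ : ℕ → LeeNF) :
      val θ (α ++ v ++ β) = val θ (ascWord n) := by
    rw [← hu]; simp only [val_append, h]
  induction h with
  | subst p hp σ =>
    have hσ (w : MonoidWord) :
        (FreeMonoid.lift σ w).toList = w.toList.flatMap fun x => (σ x).toList := by
      induction w using FreeMonoid.inductionOn' with
      | one => rfl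
      | of_mul x w ih => simp [ih]
    have hval : ∀ θ, val θ (FreeMonoid.lift σ p.1).toList =
        val θ (FreeMonoid.lift σ p.2).toList := fun θ => by
      have (w : List ℕ) : val θ (w.flatMap fun x => (σ x).toList) =
          val (fun x => val θ (σ x).toList) w := by
        induction w with
        | nil => rfl
        | cons x w ih => simp [ih]
      rw [hσ, hσ, this, this, hE p hp]
    refine ⟨hval, fun α β h => ?_⟩
    have h₁ := separated_of_val_eq h
    have h₂ := separated_of_val_eq (hcongr hval h)
    rw [hσ, hσ] at *
    obtain ⟨i, j, hij, hj, t, ht₁, ht₂⟩ := h₁.exists_lastIn hn (hE p hp) (hlen p hp) _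
    rw [← h₁.lastBefore_iff_zero_one hij hj, ← h₂.lastBefore_iff_zero_one hij hj]
    constructor <;> intro h'
    · rw [ht₁.unique h'] at ht₂; exact ht₂
    · rw [ht₂.unique h'] at ht₁; exact ht₁
  | refl u => exact ⟨fun _ => rfl, fun _ _ _ => Iff.rfl⟩
  | symm _ ih => exact ⟨fun θ => (ih.1 θ).symm, fun α β h =>
      (ih.2 α β (hcongr (fun θ => (ih.1 θ).symm) h)).symm⟩
  | trans _ _ ih₁ ih₂ => exact ⟨fun θ => (ih₁.1 θ).trans (ih₂.1 θ), fun α β h =>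
      (ih₁.2 α β h).trans (ih₂.2 α β (hcongr ih₁.1 h))⟩
  | @mul u v u' v' _ _ ih₁ ih₂ =>
    refine ⟨fun θ => by simp only [FreeMonoid.toList_mul, val_append, ih₁.1, ih₂.1],
      fun α β h => ?_⟩
    simp only [FreeMonoid.toList_mul] at h ⊢
    have e (s t : List ℕ) : α ++ (s ++ t) ++ β = α ++ s ++ (t ++ β) := by simp
    have e' (s t : List ℕ) : α ++ (s ++ t) ++ β = (α ++ s) ++ t ++ β := by simp
    rw [e] at h
    have h' := hcongr ih₁.1 h
    rw [← e, e'] at h'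
    rw [e, ih₁.2 _ _ h, ← e, e', ih₂.2 _ _ h', ← e']

theorem monoidSatisfies_iff {u v : MonoidWord} : MonoidSatisfies LeeMonoid u v ↔
    ∀ θ : ℕ → LeeNF, val θ u.toList = val θ v.toList := by
  simp only [val, ← FreeMonoid.lift_apply]
  constructor
  · intro h θ
    have := congrArg leeEquiv.toMonoidHom (h (leeEquiv.symm ∘ θ))
    rw [FreeMonoid.hom_map_lift, FreeMonoid.hom_map_lift] at this
    simpa [Function.comp_def] using this
  · intro h θ
    refine leeEquiv.injective ?_
    change leeEquiv.toMonoidHom _ = leeEquiv.toMonoidHom _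
    rw [FreeMonoid.hom_map_lift, FreeMonoid.hom_map_lift]
    exact h _

/-- A finite set of identities of the Lee monoid misses an identity between nonempty words. -/
theorem not_forall_monoidDeduces {E : Set (MonoidWord × MonoidWord)} (hE : E.Finite)
    (hsat : ∀ p ∈ E, MonoidSatisfies LeeMonoid p.1 p.2) :
    ∃ u v : MonoidWord, u ≠ 1 ∧ v ≠ 1 ∧ MonoidSatisfies LeeMonoid u v ∧ ¬ MonoidDeduces E u v := by
  obtain ⟨n, hn⟩ := (hE.image fun p => p.1.toList.length).bddAbove
  have hlast := lastBefore_ascWord n.succ_pos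
  have hlast' := lastBefore_descWord (n := n + 1)
  refine ⟨.ofList (ascWord (n + 1)), .ofList (descWord (n + 1)), ?_, ?_,
    monoidSatisfies_iff.2 (val_ascWord_eq _), fun h => ?_⟩
  · intro h; exact List.ne_nil_of_mem hlast.mem h
  · intro h; exact List.ne_nil_of_mem hlast'.mem h
  · have := (h.lastBefore_iff n.succ_pos (fun p hp => monoidSatisfies_iff.1 (hsat p hp))
      (fun p hp => (hn ⟨p, hp, rfl⟩).trans n.le_succ)).2 [] [] (by simp)
    simp only [List.nil_append, List.append_nil] at this
    exact (this.1 hlast).not_swap (by omega) hlast'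

/-- The inclusion of the free semigroup in the free monoid. -/
def toMonoidWord : SemigroupWord →ₙ* MonoidWord := FreeSemigroup.lift FreeMonoid.of

theorem lift_toMonoidWord {M : Type*} [Monoid M] (θ : ℕ → M) (u : SemigroupWord) :
    FreeMonoid.lift θ (toMonoidWord u) = FreeSemigroup.lift θ u := by
  induction u using FreeSemigroup.recOnMul with
  | ih1 x => simp [toMonoidWord]
  | ih2 x y hx hy => simp [map_mul, hx, hy]

theorem exists_toMonoidWord_eq {w : MonoidWord} (hw : w ≠ 1) : ∃ u, toMonoidWord u = w := by
  induction w using FreeMonoid.inductionOn' with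
  | one => exact absurd rfl hw
  | of_mul x w ih =>
    by_cases h : w = 1
    · exact ⟨.of x, by simp [toMonoidWord, h]⟩
    · obtain ⟨u, rfl⟩ := ih h
      exact ⟨.of x * u, by simp [toMonoidWord]⟩

theorem SemigroupDeduces.monoidDeduces {E : Set (SemigroupWord × SemigroupWord)}
    {u v : SemigroupWord} (h : SemigroupDeduces E u v) :
    MonoidDeduces (Prod.map toMonoidWord toMonoidWord '' E) (toMonoidWord u) (toMonoidWord v) := by
  induction h with
  | subst p hp θ =>
    have e (w : SemigroupWord) : toMonoidWord (FreeSemigroup.lift θ w) =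
        FreeMonoid.lift (toMonoidWord ∘ θ) (toMonoidWord w) := by
      rw [lift_toMonoidWord]
      induction w using FreeSemigroup.recOnMul with
      | ih1 x => simp
      | ih2 x y _ hy => simp [map_mul, hy]
    rw [e, e]
    exact .subst (Prod.map toMonoidWord toMonoidWord p) (Set.mem_image_of_mem _ hp) _
  | refl u => exact .refl _
  | symm _ ih => exact ih.symm
  | trans _ _ ih₁ ih₂ => exact ih₁.trans ih₂
  | mul _ _ ih₁ ih₂ => rw [map_mul, map_mul]; exact ih₁.mul ih₂

theorem corollary2p1 :
    Nat.card LeeMonoid = 9 ∧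
      ¬ MonoidFinitelyBased LeeMonoid ∧ ¬ SemigroupFinitelyBased LeeMonoid := by
  refine ⟨card_leeMonoid, ?_, ?_⟩
  · rintro ⟨E, hE, hsat, hall⟩
    obtain ⟨u, v, -, -, huv, hnot⟩ := not_forall_monoidDeduces hE hsat
    exact hnot (hall u v huv)
  · rintro ⟨E, hE, hsat, hall⟩
    obtain ⟨u, v, hu, hv, huv, hnot⟩ :=
      not_forall_monoidDeduces (hE.image (Prod.map toMonoidWord toMonoidWord)) (by
        rintro _ ⟨p, hp, rfl⟩ θ
        simpa only [Prod.map_fst, Prod.map_snd, lift_toMonoidWord] using hsat p hp θ)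
    obtain ⟨u, rfl⟩ := exists_toMonoidWord_eq hu
    obtain ⟨v, rfl⟩ := exists_toMonoidWord_eq hv
    refine hnot (hall u v fun θ => ?_).monoidDeduces
    simpa only [lift_toMonoidWord] using huv θ
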